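/- For every integer $N \ge 1$ there exists a constant $C = C(N)$, depending only on $N$, such that for every $1 \le p < \infty$ and every real-valued $u \in C_c^\infty(\mathbb{R}^N)$, $$\left[\frac{u(x)-u(y)}{|x-y|^{\frac{N+1}{p}}}\right]_{M^p(\mathbb{R}^N\times\mathbb{R}^N)} \le C\,\|u\|_{L^\infty(\mathbb{R}^N)}^{1-1/p}\,\|\nabla u\|_{L^1(\mathbb{R}^N)}^{1/p},$$ where $|\cdot|$ is the Euclidean norm, $0^0 = 1$, and, for a measurable function $f$ on $\mathbb{R}^N\times\mathbb{R}^N$, the Marcinkiewicz (weak $L^p$) quasinorm is $$[f]_{M^p(\mathbb{R}^N\times\mathbb{R}^N)} = \Bigl(\sup_{\lambda>0} \lambda^p\,\mathcal{L}^{2N}\bigl(\{(x,y)\in\mathbb{R}^N\times\mathbb{R}^N : |f(x,y)|\ge\lambda\}\bigr)\Bigr)^{1/p},$$ with $\mathcal{L}^{2N}$ the Lebesgue measure on $\mathbb{R}^N \times \mathbb{R}^N$. -/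

import Mathlib

open MeasureTheory
open scoped ENNReal NNReal

/-- The Marcinkiewicz (weak `L^p`) quasinorm
`(sup_{t > 0} t ^ p * μ {z : |f z| ≥ t}) ^ (1 / p)`, as an extended nonnegative number.
It is finite exactly when `f` (measurable) lies in `M^p`. -/
noncomputable def marcinkiewiczQuasinorm {X : Type*} [MeasurableSpace X]
    (f : X → ℝ) (p : ℝ) (μ : Measure X) : ℝ≥0∞ :=
  (⨆ (t : ℝ) (_ : 0 < t), ENNReal.ofReal (t ^ p) * μ {z | t ≤ |f z|}) ^ (1 / p)

/-!
The case `p = 1` carries the content. For `φ : ℝ → F`, an interval `[s, s + r]` with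
`t * r ^ (N + 1) ≤ ‖φ (s + r) - φ s‖` satisfies `t * r ^ (N + 1) ≤ ∫ ‖deriv φ‖` over that interval.
Covering the set of such `(s, r)` by five-fold enlargements of disjoint intervals (Vitali) bounds
its measure with weight `r ^ (N - 1)`, which is the Jacobian of polar coordinates
`y - x = r • θ`, by a multiple of `∫ ‖deriv φ‖ / t`. In place of a decomposition of the space into
lines parallel to `θ`, the estimate for `s ∈ [0, R]`, `r ∈ (0, R]` is averaged over all lines
`s ↦ x + s • θ`: by translation invariance both sides gain a factor proportional to `R`, which
cancels, and `R → ∞`.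

For `p > 1`, the bound `|g| ≤ M` turns `t ≤ |g / w ^ (1 / p)|` into
`t ^ p / M ^ (p - 1) ≤ |g / w|`, so the weak `L^p` estimate follows from the weak `L^1` one.
-/

theorem setLIntegral_prod_Ioc_pow_le (s : Set ℝ) (n : ℕ) {ρ : ℝ} (hρ : 0 ≤ ρ) :
    ∫⁻ z in s ×ˢ Set.Ioc 0 ρ, ENNReal.ofReal (z.2 ^ n)
      ≤ volume s * ENNReal.ofReal (ρ ^ (n + 1)) :=
  calc ∫⁻ z in s ×ˢ Set.Ioc 0 ρ, ENNReal.ofReal (z.2 ^ n)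
      ≤ ∫⁻ _ in s ×ˢ Set.Ioc 0 ρ, ENNReal.ofReal (ρ ^ n) :=
        setLIntegral_mono measurable_const fun _ hz =>
          ENNReal.ofReal_le_ofReal (pow_le_pow_left₀ hz.2.1.le hz.2.2 n)
    _ = volume s * ENNReal.ofReal (ρ ^ (n + 1)) := by
        rw [setLIntegral_const, Measure.volume_eq_prod, Measure.prod_prod, Real.volume_Ioc,
          sub_zero, pow_succ, ENNReal.ofReal_mul (pow_nonneg hρ n)]
        ring

theorem exists_countable_disjoint_Icc_covering {S : Set (ℝ × ℝ)} {R : ℝ}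
    (hpos : ∀ z ∈ S, 0 < z.2) (hR : ∀ z ∈ S, z.2 ≤ R) :
    ∃ v ⊆ S, v.Countable ∧ v.PairwiseDisjoint (fun z => Set.Icc z.1 (z.1 + z.2)) ∧
      S ⊆ ⋃ z ∈ v, Set.Icc (z.1 - 2 * z.2) (z.1 + 3 * z.2) ×ˢ Set.Ioc 0 (5 * z.2) := by
  obtain ⟨v, hvS, hdisj, hcov⟩ := Vitali.exists_disjoint_subfamily_covering_enlargement_closedBall
    S (fun z => z.1 + z.2 / 2) (fun z => z.2 / 2) (R / 2) (fun z hz => by linarith [hR z hz]) 5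
    (by norm_num)
  have hball (z : ℝ × ℝ) :
      Metric.closedBall (z.1 + z.2 / 2) (z.2 / 2) = Set.Icc z.1 (z.1 + z.2) := by
    rw [Real.closedBall_eq_Icc]; congr 1 <;> ring
  have hball_five (z : ℝ × ℝ) : Metric.closedBall (z.1 + z.2 / 2) (5 * (z.2 / 2))
      = Set.Icc (z.1 - 2 * z.2) (z.1 + 3 * z.2) := by
    rw [Real.closedBall_eq_Icc]; congr 1 <;> ring
  simp only [hball] at hdisj
  refine ⟨v, hvS, hdisj.countable_of_nonempty_interior fun z hz => ?_, hdisj, fun z hz => ?_⟩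
  · rw [interior_Icc, Set.nonempty_Ioo]
    linarith [hpos z (hvS hz)]
  · obtain ⟨b, hb, hzb⟩ := hcov z hz
    have hz0 := hpos z hz
    rw [hball, hball_five, Set.Icc_subset_Icc_iff (by linarith)] at hzb
    exact Set.mem_iUnion₂.2 ⟨b, hb, ⟨hzb.1, by linarith [hzb.2]⟩, hz0, by linarith [hzb.1, hzb.2]⟩

theorem exists_forall_le_of_mul_pow_le {ι : Type*} {s : Set ι} {r : ι → ℝ} {a b : ℝ≥0∞} {k : ℕ}
    (ha : a ≠ 0) (hb : b ≠ ∞) (hk : k ≠ 0)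
    (h : ∀ i ∈ s, a * ENNReal.ofReal (r i ^ k) ≤ b) : ∃ R, ∀ i ∈ s, r i ≤ R := by
  refine ⟨max 1 (b / a).toReal, fun i hi => le_max_iff.2 <| or_iff_not_imp_left.2 fun hr => ?_⟩
  have hr : 1 ≤ r i := (not_le.1 hr).le
  calc r i ≤ r i ^ k := le_self_pow₀ hr hk
    _ ≤ (b / a).toReal := by
        rw [← ENNReal.ofReal_le_iff_le_toReal (ENNReal.div_ne_top hb ha),
          ENNReal.le_div_iff_mul_le (.inl ha) (.inr hb), mul_comm]
        exact h i hi

theorem setLIntegral_Icc_prod_Ioc_pow_le (a : ℝ) {ρ : ℝ} (hρ : 0 ≤ ρ) (n : ℕ) :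
    ∫⁻ z in Set.Icc (a - 2 * ρ) (a + 3 * ρ) ×ˢ Set.Ioc 0 (5 * ρ), ENNReal.ofReal (z.2 ^ n)
      ≤ 5 ^ (n + 2) * ENNReal.ofReal (ρ ^ (n + 2)) := by
  refine (setLIntegral_prod_Ioc_pow_le _ n (by positivity)).trans_eq ?_
  rw [Real.volume_Icc, show a + 3 * ρ - (a - 2 * ρ) = 5 * ρ by ring,
    ← ENNReal.ofReal_mul (by positivity), ← pow_succ', mul_pow,
    ENNReal.ofReal_mul (by positivity), ENNReal.ofReal_pow (by positivity), ENNReal.ofReal_ofNat]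

theorem mul_setLIntegral_pow_le_of_le_measure_Icc {ν : Measure ℝ} {n : ℕ} {a : ℝ≥0∞}
    {S : Set (ℝ × ℝ)} {J : Set ℝ} (hpos : ∀ z ∈ S, 0 < z.2)
    (hJ : ∀ z ∈ S, Set.Icc z.1 (z.1 + z.2) ⊆ J)
    (hν : ∀ z ∈ S, a * ENNReal.ofReal (z.2 ^ (n + 2)) ≤ ν (Set.Icc z.1 (z.1 + z.2))) :
    a * ∫⁻ z in S, ENNReal.ofReal (z.2 ^ n) ≤ 5 ^ (n + 2) * ν J := by
  rcases eq_or_ne a 0 with rfl | ha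
  · simp
  rcases eq_or_ne (ν J) ∞ with hJtop | hJtop
  · simp [hJtop, ENNReal.mul_top]
  obtain ⟨R, hR⟩ := exists_forall_le_of_mul_pow_le ha hJtop (by omega : n + 2 ≠ 0)
    fun z hz => (hν z hz).trans (measure_mono (hJ z hz))
  obtain ⟨v, hvS, hv, hdisj, hcov⟩ := exists_countable_disjoint_Icc_covering hpos hR
  have : Countable v := hv.to_subtype
  let B (z : ℝ × ℝ) : Set (ℝ × ℝ) :=
    Set.Icc (z.1 - 2 * z.2) (z.1 + 3 * z.2) ×ˢ Set.Ioc 0 (5 * z.2)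
  have hB (z : ℝ × ℝ) (hz : z ∈ S) : a * ∫⁻ w in B z, ENNReal.ofReal (w.2 ^ n)
      ≤ 5 ^ (n + 2) * ν (Set.Icc z.1 (z.1 + z.2)) := by
    calc a * ∫⁻ w in B z, ENNReal.ofReal (w.2 ^ n)
        ≤ a * (5 ^ (n + 2) * ENNReal.ofReal (z.2 ^ (n + 2))) := by
          gcongr
          exact setLIntegral_Icc_prod_Ioc_pow_le _ (hpos z hz).le n
      _ = 5 ^ (n + 2) * (a * ENNReal.ofReal (z.2 ^ (n + 2))) := mul_left_comm _ _ _
      _ ≤ 5 ^ (n + 2) * ν (Set.Icc z.1 (z.1 + z.2)) := by gcongr; exact hν z hz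
  calc a * ∫⁻ z in S, ENNReal.ofReal (z.2 ^ n)
      ≤ a * ∑' z : v, ∫⁻ w in B z, ENNReal.ofReal (w.2 ^ n) := by
        gcongr
        refine (lintegral_mono_set hcov).trans ?_
        rw [Set.biUnion_eq_iUnion]
        exact lintegral_iUnion_le _ _
    _ ≤ ∑' z : v, 5 ^ (n + 2) * ν (Set.Icc z.1.1 (z.1.1 + z.1.2)) := by
        rw [← ENNReal.tsum_mul_left]
        exact ENNReal.tsum_le_tsum fun z => hB z (hvS z.2)
    _ = 5 ^ (n + 2) * ν (⋃ z ∈ v, Set.Icc z.1 (z.1 + z.2)) := by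
        rw [ENNReal.tsum_mul_left, measure_biUnion hv hdisj fun _ _ => measurableSet_Icc]
    _ ≤ 5 ^ (n + 2) * ν J := by
        gcongr
        exact Set.iUnion₂_subset fun z hz => hJ z (hvS hz)

theorem lintegral_lintegral_add_eq {E α : Type*} [MeasurableSpace E] [AddGroup E]
    [MeasurableAdd₂ E] [MeasurableSpace α] {μ : Measure E} [SFinite μ] [μ.IsAddRightInvariant]
    (ν : Measure α) [SFinite ν] {c : α → E} (hc : Measurable c) {g : E → ℝ≥0∞}
    (hg : Measurable g) :
    ∫⁻ x, ∫⁻ a, g (x + c a) ∂ν ∂μ = ν Set.univ * ∫⁻ x, g x ∂μ := by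
  rw [lintegral_lintegral_swap (by fun_prop)]
  simp only [lintegral_add_right_eq_self g, lintegral_const, mul_comm]

theorem lintegral_mul_measure_setOf_eq {X Y α : Type*} [MeasurableSpace X] [MeasurableSpace Y]
    [MeasurableSpace α] {μ : Measure X} [SFinite μ] {ν : Measure α} [SFinite ν] {f : α → ℝ≥0∞}
    (hf : Measurable f) {c : α → Y} (hc : Measurable c) {D : Set (X × Y)} (hD : MeasurableSet D) :
    ∫⁻ r, f r * μ {x | (x, c r) ∈ D} ∂ν
      = ∫⁻ x, ∫⁻ r, f r * D.indicator 1 (x, c r) ∂ν ∂μ := by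
  have : Measurable (D.indicator (1 : X × Y → ℝ≥0∞)) := measurable_one.indicator hD
  rw [lintegral_lintegral_swap (by fun_prop)]
  refine lintegral_congr fun r => ?_
  have hDr : MeasurableSet {x | (x, c r) ∈ D} := measurable_prodMk_right hD
  rw [lintegral_const_mul _ (by fun_prop), ← lintegral_indicator_one hDr]
  rfl

theorem lintegral_eq_lintegral_toSphere {E : Type*} [NormedAddCommGroup E] [NormedSpace ℝ E]
    [FiniteDimensional ℝ E] [Nontrivial E] [MeasurableSpace E] [BorelSpace E] (μ : Measure E)
    [μ.IsAddHaarMeasure] {G : E → ℝ≥0∞} (hG : Measurable G) :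
    ∫⁻ h, G h ∂μ = ∫⁻ θ, (∫⁻ r in Set.Ioi (0 : ℝ),
      ENNReal.ofReal (r ^ (Module.finrank ℝ E - 1)) * G (r • (θ : E))) ∂μ.toSphere := by
  have hmeas : Measurable fun z : Metric.sphere (0 : E) 1 × Set.Ioi (0 : ℝ) =>
      G ((z.2 : ℝ) • (z.1 : E)) := by fun_prop
  calc ∫⁻ h, G h ∂μ
      = ∫⁻ h : ({0}ᶜ : Set E), G h ∂μ.comap (↑) := by
        rw [lintegral_subtype_comap (measurableSet_singleton _).compl, restrict_compl_singleton]
    _ = ∫⁻ z, G ((z.2 : ℝ) • (z.1 : E))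
          ∂μ.toSphere.prod (.volumeIoiPow (Module.finrank ℝ E - 1)) := by
        rw [← μ.measurePreserving_homeomorphUnitSphereProd.lintegral_comp hmeas]
        refine lintegral_congr fun h => ?_
        congr 1
        simp [smul_smul, norm_ne_zero_iff.2 h.2]
    _ = _ := by
        rw [lintegral_prod _ hmeas.aemeasurable]
        refine lintegral_congr fun θ => ?_
        rw [Measure.volumeIoiPow,
          lintegral_withDensity_eq_lintegral_mul _ (by fun_prop) (by fun_prop),
          ← lintegral_subtype_comap measurableSet_Ioi]
        rfl

theorem eLpNorm_top_sub_prod_le {X F : Type*} [MeasurableSpace X] [NormedAddCommGroup F]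
    {μ : Measure X} [SFinite μ] (u : X → F) :
    eLpNorm (fun z : X × X => u z.1 - u z.2) ∞ (μ.prod μ) ≤ 2 * eLpNorm u ∞ μ := by
  simp only [eLpNorm_exponent_top]
  refine eLpNormEssSup_le_of_ae_enorm_bound ?_
  filter_upwards [Measure.quasiMeasurePreserving_fst.ae (ae_le_eLpNormEssSup (f := u)),
    Measure.quasiMeasurePreserving_snd.ae (ae_le_eLpNormEssSup (f := u))] with z h₁ h₂
  calc ‖u z.1 - u z.2‖ₑ ≤ ‖u z.1‖ₑ + ‖u z.2‖ₑ := enorm_sub_le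
    _ ≤ 2 * eLpNormEssSup u μ := by rw [two_mul]; gcongr

theorem mul_rpow_one_sub_mul_mul_rpow_le {a b x y : ℝ≥0∞} {θ : ℝ} (hθ₀ : 0 ≤ θ) (hθ₁ : θ ≤ 1) :
    (a * x) ^ (1 - θ) * (b * y) ^ θ ≤ max a b * x ^ (1 - θ) * y ^ θ := by
  have hθ : 0 ≤ 1 - θ := sub_nonneg.2 hθ₁
  calc (a * x) ^ (1 - θ) * (b * y) ^ θ
      ≤ (max a b * x) ^ (1 - θ) * (max a b * y) ^ θ := by
        gcongr
        · exact le_max_left a b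
        · exact le_max_right a b
    _ = max a b * x ^ (1 - θ) * y ^ θ := by
        rw [ENNReal.mul_rpow_of_nonneg _ _ hθ, ENNReal.mul_rpow_of_nonneg _ _ hθ₀,
          mul_mul_mul_comm, ← ENNReal.rpow_add_of_nonneg _ _ hθ hθ₀, sub_add_cancel,
          ENNReal.rpow_one, mul_assoc]

theorem eLpNorm_gradient_eq {E : Type*} [NormedAddCommGroup E] [InnerProductSpace ℝ E]
    [CompleteSpace E] [MeasurableSpace E] (u : E → ℝ) (p : ℝ≥0∞) (μ : Measure E) :
    eLpNorm (fun x => gradient u x) p μ = eLpNorm (fderiv ℝ u) p μ :=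
  eLpNorm_congr_norm_ae <| .of_forall fun _ => (InnerProductSpace.toDual ℝ E).symm.norm_map _

section Marcinkiewicz

variable {X : Type*} [MeasurableSpace X] {μ : Measure X}

theorem mul_measure_le_marcinkiewiczQuasinorm_one (f : X → ℝ) {t : ℝ} (ht : 0 < t) :
    ENNReal.ofReal t * μ {z | t ≤ |f z|} ≤ marcinkiewiczQuasinorm f 1 μ := by
  simpa only [marcinkiewiczQuasinorm, Real.rpow_one, div_one, ENNReal.rpow_one] using
    le_iSup₂ (f := fun (s : ℝ) (_ : 0 < s) => ENNReal.ofReal s * μ {z | s ≤ |f z|}) t ht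

theorem marcinkiewiczQuasinorm_le_iff {f : X → ℝ} {p : ℝ} (hp : 0 < p) {C : ℝ≥0∞} :
    marcinkiewiczQuasinorm f p μ ≤ C ↔
      ∀ t : ℝ, 0 < t → ENNReal.ofReal (t ^ p) * μ {z | t ≤ |f z|} ≤ C ^ p := by
  rw [marcinkiewiczQuasinorm, one_div, ENNReal.rpow_inv_le_iff hp, iSup₂_le_iff]

theorem marcinkiewiczQuasinorm_eq_zero_iff {f : X → ℝ} {p : ℝ} (hp : 0 < p) :
    marcinkiewiczQuasinorm f p μ = 0 ↔ f =ᵐ[μ] 0 := by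
  have hlevel : (∀ t : ℝ, 0 < t → μ {z | t ≤ |f z|} = 0) ↔ f =ᵐ[μ] 0 := by
    refine ⟨fun h => ?_, fun h t ht => measure_mono_null ?_ (ae_iff.1 h)⟩
    · refine measure_mono_null (fun z hz => ?_)
        (measure_iUnion_null fun n : ℕ => h (1 / (n + 1)) (by positivity))
      obtain ⟨n, hn⟩ := exists_nat_one_div_lt (abs_pos.2 hz)
      exact Set.mem_iUnion.2 ⟨n, hn.le⟩
    · intro z (hz : t ≤ |f z|) (hz0 : f z = 0)
      exact ht.not_ge (by simpa only [hz0, abs_zero] using hz)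
  rw [← hlevel, ← nonpos_iff_eq_zero, marcinkiewiczQuasinorm_le_iff hp]
  refine forall₂_congr fun t ht => ?_
  rw [ENNReal.zero_rpow_of_pos hp, nonpos_iff_eq_zero, mul_eq_zero, or_iff_right]
  exact (ENNReal.ofReal_pos.2 (Real.rpow_pos_of_pos ht p)).ne'

theorem div_rpow_le_abs_div_of_le_abs_div_rpow {a w t M p : ℝ} (hp : 1 ≤ p) (ht : 0 < t)
    (hw : 0 ≤ w) (ha : |a| ≤ M) (h : t ≤ |a / w ^ (1 / p)|) :
    t ^ p / M ^ (p - 1) ≤ |a / w| := by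
  have ha0 : 0 < |a| := abs_pos.2 fun ha0 => ht.not_ge (by simpa [ha0] using h)
  have hp0 : 0 < p := by linarith
  have hM : 0 < M := ha0.trans_le ha
  rw [div_le_iff₀ (Real.rpow_pos_of_pos hM _)]
  calc t ^ p ≤ |a / w ^ (1 / p)| ^ p := Real.rpow_le_rpow ht.le h hp0.le
    _ = |a / w| * |a| ^ (p - 1) := by
        rw [abs_div, abs_div, abs_of_nonneg hw, abs_of_nonneg (Real.rpow_nonneg hw _),
          Real.div_rpow ha0.le (Real.rpow_nonneg hw _), ← Real.rpow_mul hw,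
          one_div_mul_cancel hp0.ne', Real.rpow_one, Real.rpow_sub_one ha0.ne']
        field_simp
    _ ≤ |a / w| * M ^ (p - 1) := by gcongr

theorem marcinkiewiczQuasinorm_div_rpow_le_of_ae_le {g w : X → ℝ} (hw : 0 ≤ w) {p : ℝ}
    (hp : 1 ≤ p) {M : ℝ} (hM : 0 < M) (hg : ∀ᵐ z ∂μ, |g z| ≤ M) :
    marcinkiewiczQuasinorm (fun z => g z / w z ^ (1 / p)) p μ
      ≤ ENNReal.ofReal M ^ (1 - 1 / p) *
        marcinkiewiczQuasinorm (fun z => g z / w z) 1 μ ^ (1 / p) := by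
  have hp0 : 0 < p := by linarith
  have hMp : 0 < M ^ (p - 1) := Real.rpow_pos_of_pos hM _
  set K := marcinkiewiczQuasinorm (fun z => g z / w z) 1 μ
  have hpow : (ENNReal.ofReal M ^ (1 - 1 / p) * K ^ (1 / p)) ^ p
      = ENNReal.ofReal (M ^ (p - 1)) * K := by
    rw [ENNReal.mul_rpow_of_nonneg _ _ hp0.le, ← ENNReal.rpow_mul, ← ENNReal.rpow_mul,
      one_div_mul_cancel hp0.ne', ENNReal.rpow_one, sub_mul, one_div_mul_cancel hp0.ne', one_mul,
      ENNReal.ofReal_rpow_of_pos hM]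
  rw [marcinkiewiczQuasinorm_le_iff hp0, hpow]
  intro t ht
  calc ENNReal.ofReal (t ^ p) * μ {z | t ≤ |g z / w z ^ (1 / p)|}
      ≤ ENNReal.ofReal (t ^ p) * μ {z | t ^ p / M ^ (p - 1) ≤ |g z / w z|} := by
        gcongr ENNReal.ofReal (t ^ p) * ?_
        refine measure_mono_ae ?_
        filter_upwards [hg] with z hz using
          div_rpow_le_abs_div_of_le_abs_div_rpow hp ht (hw z) hz
    _ = ENNReal.ofReal (M ^ (p - 1)) * (ENNReal.ofReal (t ^ p / M ^ (p - 1)) *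
          μ {z | t ^ p / M ^ (p - 1) ≤ |g z / w z|}) := by
        rw [← mul_assoc, ← ENNReal.ofReal_mul hMp.le, mul_div_cancel₀ _ hMp.ne']
    _ ≤ ENNReal.ofReal (M ^ (p - 1)) * K := by
        gcongr
        exact mul_measure_le_marcinkiewiczQuasinorm_one _ (by positivity)

theorem marcinkiewiczQuasinorm_div_rpow_le {g w : X → ℝ} (hw : 0 ≤ w) {p : ℝ} (hp : 1 ≤ p) :
    marcinkiewiczQuasinorm (fun z => g z / w z ^ (1 / p)) p μ
      ≤ eLpNorm g ∞ μ ^ (1 - 1 / p) *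
        marcinkiewiczQuasinorm (fun z => g z / w z) 1 μ ^ (1 / p) := by
  have hp0 : 0 < p := by linarith
  set K := marcinkiewiczQuasinorm (fun z => g z / w z) 1 μ
  rw [eLpNorm_exponent_top]
  rcases eq_or_ne K 0 with hK0 | hK0
  · have hquot := (marcinkiewiczQuasinorm_eq_zero_iff one_pos).1 hK0
    refine le_of_eq_of_le ((marcinkiewiczQuasinorm_eq_zero_iff hp0).2 ?_) zero_le
    filter_upwards [hquot] with z hz
    rcases div_eq_zero_iff.1 hz with h | h
    · simp [h]
    · simp [h, hp0.ne']
  rcases eq_or_ne (eLpNormEssSup g μ) 0 with hM0 | hM0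
  · refine absurd ((marcinkiewiczQuasinorm_eq_zero_iff one_pos).2 ?_) hK0
    filter_upwards [eLpNormEssSup_eq_zero_iff.1 hM0] with z hz
    simp [hz]
  rcases hp.eq_or_lt with rfl | hp1
  · simp [K]
  rcases eq_or_ne (eLpNormEssSup g μ) ∞ with hMtop | hMtop
  · have : 0 < 1 - 1 / p := sub_pos.2 ((div_lt_one hp0).2 hp1)
    have hKp : K ^ (1 / p) ≠ 0 := by simp [ENNReal.rpow_eq_zero_iff, hK0, hp0.le]
    rw [hMtop, ENNReal.top_rpow_of_pos this, ENNReal.top_mul hKp]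
    exact le_top
  have hg : ∀ᵐ z ∂μ, |g z| ≤ (eLpNormEssSup g μ).toReal := by
    filter_upwards [ae_le_eLpNormEssSup (f := g)] with z hz
    simpa using ENNReal.toReal_mono hMtop hz
  simpa only [ENNReal.ofReal_toReal hMtop] using
    marcinkiewiczQuasinorm_div_rpow_le_of_ae_le hw hp (ENNReal.toReal_pos hM0 hMtop) hg

end Marcinkiewicz

/-- The pairs `(x, h)`, base point and increment, at which the difference quotient
`‖u (x + h) - u x‖ / ‖h‖ ^ k` is at least `t`. The inequality is cleared of its denominator, so the
set is closed for continuous `u` and contains every `(x, 0)` when `k ≠ 0`. -/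
def diffQuotientSuperlevel {E F : Type*} [NormedAddCommGroup E] [NormedAddCommGroup F]
    (u : E → F) (k : ℕ) (t : ℝ) : Set (E × E) :=
  {z | t * ‖z.2‖ ^ k ≤ ‖u (z.1 + z.2) - u z.1‖}

section DiffQuotient

variable {E F : Type*} [NormedAddCommGroup E] [NormedAddCommGroup F]

theorem isClosed_diffQuotientSuperlevel {u : E → F} (hu : Continuous u) (k : ℕ) (t : ℝ) :
    IsClosed (diffQuotientSuperlevel u k t) :=
  isClosed_le (by fun_prop) (by fun_prop)

theorem mk_mem_diffQuotientSuperlevel_line_iff [NormedSpace ℝ E] {u : E → F} {k : ℕ} {t : ℝ}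
    {x θ : E} (hθ : ‖θ‖ = 1) {s r : ℝ} :
    (s, r) ∈ diffQuotientSuperlevel (fun τ : ℝ => u (x + τ • θ)) k t ↔
      (x + s • θ, r • θ) ∈ diffQuotientSuperlevel u k t := by
  simp only [diffQuotientSuperlevel, Set.mem_ofPred_eq, norm_smul, hθ, mul_one, add_smul, add_assoc]

theorem ofReal_mul_setLIntegral_pow_le_setLIntegral_deriv [NormedSpace ℝ F] {φ : ℝ → F}
    (hφ : ContDiff ℝ 1 φ) {n : ℕ} {t : ℝ} {S : Set (ℝ × ℝ)} {J : Set ℝ}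
    (hS : S ⊆ diffQuotientSuperlevel φ (n + 2) t) (hpos : ∀ z ∈ S, 0 < z.2)
    (hJ : ∀ z ∈ S, Set.Icc z.1 (z.1 + z.2) ⊆ J) :
    ENNReal.ofReal t * ∫⁻ z in S, ENNReal.ofReal (z.2 ^ n)
      ≤ 5 ^ (n + 2) * ∫⁻ s in J, ‖deriv φ s‖ₑ := by
  rw [← withDensity_apply' _ J]
  refine mul_setLIntegral_pow_le_of_le_measure_Icc hpos hJ fun ⟨s, r⟩ hz => ?_
  have hr : 0 < r := hpos _ hz
  calc ENNReal.ofReal t * ENNReal.ofReal (r ^ (n + 2))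
      = ENNReal.ofReal (t * ‖r‖ ^ (n + 2)) := by
        rw [Real.norm_of_nonneg hr.le, ENNReal.ofReal_mul' (by positivity)]
    _ ≤ ‖φ (s + r) - φ s‖ₑ := by
        rw [← ofReal_norm]
        exact ENNReal.ofReal_le_ofReal (hS hz)
    _ ≤ ∫⁻ τ in Set.Icc s (s + r), ‖deriv φ τ‖ₑ :=
        enorm_sub_le_lintegral_deriv_of_contDiffOn_Icc hφ.contDiffOn (by linarith)
    _ = volume.withDensity (fun τ => ‖deriv φ τ‖ₑ) (Set.Icc s (s + r)) :=
        (withDensity_apply' _ _).symm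

theorem prod_setOf_mul_norm_pow_le_eq_lintegral [MeasurableSpace E] [BorelSpace E]
    [SecondCountableTopology E] (μ : Measure E) [SFinite μ] [μ.IsAddLeftInvariant] {u : E → F}
    (hu : Continuous u) (k : ℕ) (t : ℝ) :
    (μ.prod μ) {z | t * ‖z.1 - z.2‖ ^ k ≤ ‖u z.1 - u z.2‖}
      = ∫⁻ h, μ {x | (x, h) ∈ diffQuotientSuperlevel u k t} ∂μ := by
  have hclosed : IsClosed {z : E × E | t * ‖z.1 - z.2‖ ^ k ≤ ‖u z.1 - u z.2‖} :=
    isClosed_le (by fun_prop) (by fun_prop)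
  have hD : MeasurableSet (diffQuotientSuperlevel u k t) :=
    (isClosed_diffQuotientSuperlevel hu k t).measurableSet
  rw [← (measurePreserving_prod_add μ μ).measure_preimage hclosed.measurableSet.nullMeasurableSet]
  refine Eq.trans ?_ (Measure.prod_apply_symm hD)
  congr 1
  ext ⟨x, h⟩
  simp only [diffQuotientSuperlevel, Set.mem_preimage, Set.mem_ofPred_eq, sub_add_cancel_left,
    norm_neg, norm_sub_rev (u x)]

variable [NormedSpace ℝ E] [NormedSpace ℝ F]

theorem enorm_deriv_comp_line_le {u : E → F} (hu : Differentiable ℝ u) {x θ : E} (hθ : ‖θ‖ = 1)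
    (s : ℝ) : ‖deriv (fun τ : ℝ => u (x + τ • θ)) s‖ₑ ≤ ‖fderiv ℝ u (x + s • θ)‖ₑ := by
  have hline : HasDerivAt (fun τ : ℝ => x + τ • θ) θ s := by
    simpa only [id_eq, one_smul] using ((hasDerivAt_id s).smul_const θ).const_add x
  have hcomp : HasDerivAt (fun τ : ℝ => u (x + τ • θ)) (fderiv ℝ u (x + s • θ) θ) s :=
    (hu _).hasFDerivAt.comp_hasDerivAt s hline
  rw [hcomp.deriv]
  simpa only [← ofReal_norm, hθ, ENNReal.ofReal_one, mul_one] using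
    (fderiv ℝ u (x + s • θ)).le_opENorm θ

theorem ofReal_mul_setLIntegral_indicator_line_le {u : E → F} (hu : ContDiff ℝ 1 u) (x : E) {θ : E}
    (hθ : ‖θ‖ = 1) (n : ℕ) (t R : ℝ) :
    ENNReal.ofReal t * ∫⁻ s in Set.Icc 0 R, ∫⁻ r in Set.Ioc 0 R, ENNReal.ofReal (r ^ n) *
        (diffQuotientSuperlevel u (n + 2) t).indicator 1 (x + s • θ, r • θ)
      ≤ 5 ^ (n + 2) * ∫⁻ s in Set.Icc 0 (2 * R), ‖fderiv ℝ u (x + s • θ)‖ₑ := by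
  let φ : ℝ → F := fun τ => u (x + τ • θ)
  have hφ : ContDiff ℝ 1 φ := by fun_prop
  let W : Set (ℝ × ℝ) := Set.Icc 0 R ×ˢ Set.Ioc 0 R
  let S : Set (ℝ × ℝ) := diffQuotientSuperlevel φ (n + 2) t
  have hS : MeasurableSet S := (isClosed_diffQuotientSuperlevel hφ.continuous _ _).measurableSet
  have hmem (s r : ℝ) : (s, r) ∈ S ↔ (x + s • θ, r • θ) ∈ diffQuotientSuperlevel u (n + 2) t :=
    mk_mem_diffQuotientSuperlevel_line_iff hθ
  have hdouble : ∫⁻ s in Set.Icc 0 R, ∫⁻ r in Set.Ioc 0 R, ENNReal.ofReal (r ^ n) *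
        (diffQuotientSuperlevel u (n + 2) t).indicator 1 (x + s • θ, r • θ)
      = ∫⁻ z in S ∩ W, ENNReal.ofReal (z.2 ^ n) := by
    rw [← setLIntegral_indicator hS, Measure.volume_eq_prod, setLIntegral_prod]
    · refine lintegral_congr fun s => lintegral_congr fun r => ?_
      by_cases h : (s, r) ∈ S
      · rw [Set.indicator_of_mem h, Set.indicator_of_mem ((hmem s r).1 h), Pi.one_apply, mul_one]
      · rw [Set.indicator_of_notMem h, Set.indicator_of_notMem (mt (hmem s r).2 h), mul_zero]
    · exact (Measurable.indicator (by fun_prop) hS).aemeasurable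
  rw [hdouble]
  refine (ofReal_mul_setLIntegral_pow_le_setLIntegral_deriv (J := Set.Icc 0 (2 * R)) hφ
    Set.inter_subset_left (fun z hz => hz.2.2.1) fun z hz => ?_).trans ?_
  · exact Set.Icc_subset_Icc hz.2.1.1 (by linarith [hz.2.1.2, hz.2.2.2])
  · gcongr with s
    exact enorm_deriv_comp_line_le (hu.differentiable one_ne_zero) hθ s

variable [MeasurableSpace E] [BorelSpace E]

section AddLeftInvariant

variable [SecondCountableTopology E] (μ : Measure E) [SFinite μ] [μ.IsAddLeftInvariant]

theorem ofReal_mul_setLIntegral_Ioc_measure_diffQuotientSuperlevel_le {u : E → F}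
    (hu : ContDiff ℝ 1 u) {θ : E} (hθ : ‖θ‖ = 1) (n : ℕ) (t : ℝ) {R : ℝ} (hR : 0 < R) :
    ENNReal.ofReal t * ∫⁻ r in Set.Ioc 0 R, ENNReal.ofReal (r ^ n) *
        μ {x | (x, r • θ) ∈ diffQuotientSuperlevel u (n + 2) t}
      ≤ 2 * 5 ^ (n + 2) * ∫⁻ x, ‖fderiv ℝ u x‖ₑ ∂μ := by
  let D : Set (E × E) := diffQuotientSuperlevel u (n + 2) t
  have hD : MeasurableSet D := (isClosed_diffQuotientSuperlevel hu.continuous _ _).measurableSet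
  let k : E × ℝ → ℝ≥0∞ := fun z => ENNReal.ofReal (z.2 ^ n) * D.indicator 1 (z.1, z.2 • θ)
  have hk : Measurable k := by
    have : Measurable (D.indicator (1 : E × E → ℝ≥0∞)) := measurable_one.indicator hD
    fun_prop
  have hgrad : Measurable fun x => ‖fderiv ℝ u x‖ₑ :=
    (hu.continuous_fderiv one_ne_zero).enorm.measurable
  have hline : Measurable fun s : ℝ => s • θ := by fun_prop
  have hfubini : ∫⁻ r in Set.Ioc 0 R, ENNReal.ofReal (r ^ n) * μ {x | (x, r • θ) ∈ D}
      = ∫⁻ x, (∫⁻ r in Set.Ioc 0 R, k (x, r)) ∂μ :=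
    lintegral_mul_measure_setOf_eq (by fun_prop) hline hD
  refine (ENNReal.mul_le_mul_iff_right (ENNReal.ofReal_pos.2 hR).ne' ENNReal.ofReal_ne_top).1 ?_
  calc ENNReal.ofReal R * (ENNReal.ofReal t *
        ∫⁻ r in Set.Ioc 0 R, ENNReal.ofReal (r ^ n) * μ {x | (x, r • θ) ∈ D})
      = ENNReal.ofReal t * ∫⁻ x, (∫⁻ s in Set.Icc 0 R, ∫⁻ r in Set.Ioc 0 R,
          k (x + s • θ, r)) ∂μ := by
        rw [lintegral_lintegral_add_eq _ hline hk.lintegral_prod_right', hfubini,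
          Measure.restrict_apply_univ, Real.volume_Icc, sub_zero, mul_left_comm]
    _ = ∫⁻ x, ENNReal.ofReal t * (∫⁻ s in Set.Icc 0 R, ∫⁻ r in Set.Ioc 0 R,
          k (x + s • θ, r)) ∂μ := (lintegral_const_mul' _ _ ENNReal.ofReal_ne_top).symm
    _ ≤ ∫⁻ x, 5 ^ (n + 2) * (∫⁻ s in Set.Icc 0 (2 * R), ‖fderiv ℝ u (x + s • θ)‖ₑ) ∂μ :=
        lintegral_mono fun x => ofReal_mul_setLIntegral_indicator_line_le hu x hθ n t R
    _ = ENNReal.ofReal R * (2 * 5 ^ (n + 2) * ∫⁻ x, ‖fderiv ℝ u x‖ₑ ∂μ) := by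
        rw [lintegral_const_mul' _ _ (by finiteness), lintegral_lintegral_add_eq _ hline hgrad,
          Measure.restrict_apply_univ, Real.volume_Icc, sub_zero, ENNReal.ofReal_mul two_pos.le,
          ENNReal.ofReal_ofNat]
        ring

theorem ofReal_mul_setLIntegral_Ioi_measure_diffQuotientSuperlevel_le {u : E → F}
    (hu : ContDiff ℝ 1 u) {θ : E} (hθ : ‖θ‖ = 1) (n : ℕ) (t : ℝ) :
    ENNReal.ofReal t * ∫⁻ r in Set.Ioi 0, ENNReal.ofReal (r ^ n) *
        μ {x | (x, r • θ) ∈ diffQuotientSuperlevel u (n + 2) t}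
      ≤ 2 * 5 ^ (n + 2) * ∫⁻ x, ‖fderiv ℝ u x‖ₑ ∂μ := by
  have hunion : ⋃ m : ℕ, Set.Ioc (0 : ℝ) (m + 1) = Set.Ioi 0 :=
    Set.iUnion_Ioc_eq_Ioi_self_iff.2 fun x _ => (exists_nat_ge x).imp fun m hm => by linarith
  have hmono : Monotone fun m : ℕ => Set.Ioc (0 : ℝ) (m + 1) := fun _ _ h =>
    Set.Ioc_subset_Ioc_right (by gcongr)
  rw [← hunion, setLIntegral_iUnion_of_directed _ hmono.directed_le, ENNReal.mul_iSup]
  exact iSup_le fun m =>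
    ofReal_mul_setLIntegral_Ioc_measure_diffQuotientSuperlevel_le μ hu hθ n t (by positivity)

end AddLeftInvariant

theorem ofReal_mul_prod_setOf_mul_norm_pow_le_lintegral_fderiv [FiniteDimensional ℝ E]
    [Nontrivial E] (μ : Measure E) [μ.IsAddHaarMeasure] {u : E → F} (hu : ContDiff ℝ 1 u) (t : ℝ) :
    ENNReal.ofReal t * (μ.prod μ)
        {z | t * ‖z.1 - z.2‖ ^ (Module.finrank ℝ E + 1) ≤ ‖u z.1 - u z.2‖}
      ≤ 2 * 5 ^ (Module.finrank ℝ E + 1) * μ.toSphere Set.univ *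
        ∫⁻ x, ‖fderiv ℝ u x‖ₑ ∂μ := by
  obtain ⟨n, hn⟩ : ∃ n, Module.finrank ℝ E = n + 1 :=
    Nat.exists_eq_add_one.2 Module.finrank_pos
  have hD : MeasurableSet (diffQuotientSuperlevel u (Module.finrank ℝ E + 1) t) :=
    (isClosed_diffQuotientSuperlevel hu.continuous _ _).measurableSet
  have hslice : Measurable fun h =>
      μ {x | (x, h) ∈ diffQuotientSuperlevel u (Module.finrank ℝ E + 1) t} :=
    measurable_measure_prodMk_right hD
  rw [prod_setOf_mul_norm_pow_le_eq_lintegral μ hu.continuous,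
    lintegral_eq_lintegral_toSphere μ hslice, ← lintegral_const_mul' _ _ ENNReal.ofReal_ne_top, hn]
  calc _ ≤ ∫⁻ _, 2 * 5 ^ (n + 2) * ∫⁻ x, ‖fderiv ℝ u x‖ₑ ∂μ ∂μ.toSphere :=
        lintegral_mono fun θ => ofReal_mul_setLIntegral_Ioi_measure_diffQuotientSuperlevel_le μ hu
          (mem_sphere_zero_iff_norm.1 θ.2) n t
    _ = 2 * 5 ^ (n + 2) * μ.toSphere Set.univ * ∫⁻ x, ‖fderiv ℝ u x‖ₑ ∂μ := by
        rw [lintegral_const]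
        ring

theorem marcinkiewiczQuasinorm_diffQuotient_one_le [FiniteDimensional ℝ E] [Nontrivial E]
    (μ : Measure E) [μ.IsAddHaarMeasure] {u : E → F} (hu : ContDiff ℝ 1 u) :
    marcinkiewiczQuasinorm
        (fun z : E × E => ‖u z.1 - u z.2‖ / ‖z.1 - z.2‖ ^ (Module.finrank ℝ E + 1)) 1 (μ.prod μ)
      ≤ 2 * 5 ^ (Module.finrank ℝ E + 1) * μ.toSphere Set.univ * eLpNorm (fderiv ℝ u) 1 μ := by
  rw [marcinkiewiczQuasinorm_le_iff one_pos]
  intro t _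
  rw [Real.rpow_one, ENNReal.rpow_one, eLpNorm_one_eq_lintegral_enorm]
  refine le_trans ?_ (ofReal_mul_prod_setOf_mul_norm_pow_le_lintegral_fderiv μ hu t)
  gcongr ENNReal.ofReal t * (μ.prod μ) ?_
  intro z (hz : t ≤ |‖u z.1 - u z.2‖ / ‖z.1 - z.2‖ ^ (Module.finrank ℝ E + 1)|)
  rw [abs_of_nonneg (by positivity)] at hz
  exact mul_le_of_le_div₀ (by positivity) (by positivity) hz

end DiffQuotient

theorem theorem4_general {E : Type*} [NormedAddCommGroup E] [NormedSpace ℝ E]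
    [FiniteDimensional ℝ E] [Nontrivial E] [MeasurableSpace E] [BorelSpace E] (μ : Measure E)
    [μ.IsAddHaarMeasure] :
    ∃ C : ℝ≥0, ∀ p : ℝ, 1 ≤ p →
      ∀ {F : Type*} [NormedAddCommGroup F] [NormedSpace ℝ F] (u : E → F), ContDiff ℝ 1 u →
        marcinkiewiczQuasinorm
            (fun z : E × E =>
              ‖u z.1 - u z.2‖ / ‖z.1 - z.2‖ ^ (((Module.finrank ℝ E : ℝ) + 1) / p))
            p (μ.prod μ)
          ≤ C * eLpNorm u ∞ μ ^ (1 - 1 / p) * eLpNorm (fderiv ℝ u) 1 μ ^ (1 / p) := by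
  set K := 2 * 5 ^ (Module.finrank ℝ E + 1) * μ.toSphere Set.univ
  have hK : K ≠ ∞ := by finiteness
  have hC : max 2 K ≠ ∞ := by finiteness
  refine ⟨(max 2 K).toNNReal, fun p hp F _ _ u hu => ?_⟩
  have hp₁ : 1 / p ≤ 1 := (div_le_one (by positivity)).2 hp
  have hden (z : E × E) : ‖z.1 - z.2‖ ^ (((Module.finrank ℝ E : ℝ) + 1) / p)
      = (‖z.1 - z.2‖ ^ (Module.finrank ℝ E + 1)) ^ (1 / p) := by
    rw [← Real.rpow_natCast_mul (norm_nonneg _), Nat.cast_add_one, mul_one_div]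
  simp only [hden, ENNReal.coe_toNNReal hC]
  calc _ ≤ eLpNorm (fun z : E × E => ‖u z.1 - u z.2‖) ∞ (μ.prod μ) ^ (1 - 1 / p) *
        marcinkiewiczQuasinorm (fun z : E × E =>
          ‖u z.1 - u z.2‖ / ‖z.1 - z.2‖ ^ (Module.finrank ℝ E + 1)) 1 (μ.prod μ) ^ (1 / p) :=
        marcinkiewiczQuasinorm_div_rpow_le (fun _ => by positivity) hp
    _ ≤ (2 * eLpNorm u ∞ μ) ^ (1 - 1 / p) * (K * eLpNorm (fderiv ℝ u) 1 μ) ^ (1 / p) := by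
        gcongr
        · rw [eLpNorm_norm]
          exact eLpNorm_top_sub_prod_le u
        · exact marcinkiewiczQuasinorm_diffQuotient_one_le μ hu
    _ ≤ max 2 K * eLpNorm u ∞ μ ^ (1 - 1 / p) * eLpNorm (fderiv ℝ u) 1 μ ^ (1 / p) :=
        mul_rpow_one_sub_mul_mul_rpow_le (by positivity) hp₁

theorem theorem4 (N : ℕ) (hN : 1 ≤ N) :
    ∃ C : ℝ≥0, ∀ p : ℝ, 1 ≤ p →
      ∀ u : EuclideanSpace ℝ (Fin N) → ℝ, ContDiff ℝ (⊤ : ℕ∞) u → HasCompactSupport u →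
        marcinkiewiczQuasinorm
            (fun z : EuclideanSpace ℝ (Fin N) × EuclideanSpace ℝ (Fin N) =>
              (u z.1 - u z.2) / ‖z.1 - z.2‖ ^ (((N : ℝ) + 1) / p))
            p (volume.prod volume)
          ≤ (C : ℝ≥0∞) * eLpNorm u ∞ volume ^ (1 - 1 / p)
              * eLpNorm (fun x => gradient u x) 1 volume ^ (1 / p) := by
  have : Nontrivial (EuclideanSpace ℝ (Fin N)) :=
    Module.nontrivial_of_finrank_pos (R := ℝ) (by rwa [finrank_euclideanSpace_fin])
  obtain ⟨C, hC⟩ := theorem4_general (volume : Measure (EuclideanSpace ℝ (Fin N)))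
  refine ⟨C, fun p hp u hu _ => ?_⟩
  have hCu := hC p hp u (hu.of_le (by exact_mod_cast le_top))
  rw [finrank_euclideanSpace_fin] at hCu
  simpa only [marcinkiewiczQuasinorm, eLpNorm_gradient_eq, abs_div, Real.norm_eq_abs, abs_abs]
    using hCu
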